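/- All graphs are finite, simple and undirected. A graph is \emph{matching covered} if it is connected and each of its edges lies in a perfect matching. For $X\subseteq V(G)$ let $\partial(X)$ be the set of edges joining $X$ to $V(G)\setminus X$; its \emph{matching porosity} is $\max_M |M\cap\partial(X)|$ over all perfect matchings $M$ of $G$. A \emph{perfect matching decomposition} of $G$ is a pair $(T,\delta)$ where $T$ is a cubic tree (every vertex has degree $1$ or $3$) and $\delta$ is a bijection from the leaves of $T$ to $V(G)$. Every edge $t_1t_2$ of $T$ induces the cut $\partial(X)$ of $G$, where $X$ is the set of vertices to which $\delta$ maps the leaves of $T$ lying in the component of $T-t_1t_2$ that contains $t_1$. The \emph{width} of $(T,\delta)$ is the maximum matching porosity of the cuts induced by the edges of $T$, and the \emph{perfect matching width} $\mathrm{pmw}(G)$ is the minimum width of a perfect matching decomposition of $G$ (with $\mathrm{pmw}(G)=\infty$ for the one-vertex graph, which has no such decomposition). A cut $\partial(Z)$ of a matching covered graph is \emph{tight} if every perfect matching meets it in exactly one edge, and \emph{nontrivial} if neither $Z$ nor $V(G)\setminus Z$ consists of a single vertex. The \emph{tight cut contraction} $G_Z$ arises from $G$ by identifying the shore $Z$ of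 a nontrivial tight cut into a single vertex and deleting loops and parallel edges. A matching covered graph without nontrivial tight cuts is called a \emph{brace} if it is bipartite and a \emph{brick} otherwise. The \emph{bricks and braces of} a matching covered graph $G$ are, up to isomorphism, the bricks and braces obtained by the tight cut decomposition of $G$: as long as a current graph has a nontrivial tight cut $\partial(Z)$, it is replaced by its two contractions with respect to $Z$ and $V(G)\setminus Z$. \textbf{Corollary.} Let $G$ be a matching covered graph and let $H$ be a brick or brace of $G$. Then $$\mathrm{pmw}(H)\le 2\,\mathrm{pmw}(G).$$ -/

import Mathlib

universe u w

namespace PMWidth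

/-- The cut `∂(X)`: all edges of `G` joining a vertex of `X` to a vertex outside `X`. -/
def cut {V : Type u} (G : SimpleGraph V) (X : Set V) : Set (Sym2 V) :=
  {e | ∃ x ∈ X, ∃ y ∉ X, G.Adj x y ∧ e = s(x, y)}

/-- `G` is matching covered: it is connected and each of its edges lies in a perfect matching. -/
def MatchingCovered {V : Type u} (G : SimpleGraph V) : Prop :=
  G.Connected ∧
    ∀ e ∈ G.edgeSet, ∃ M : G.Subgraph, M.IsPerfectMatching ∧ e ∈ M.edgeSet

/-- The matching porosity of the cut `∂(X)`: the maximum number of edges in which a perfect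
matching of `G` meets `∂(X)`. (For finite `G` with a perfect matching the supremum is a
maximum, and it is a natural number.) -/
noncomputable def matchingPorosity {V : Type u} (G : SimpleGraph V) (X : Set V) : ℕ∞ :=
  ⨆ M : {M : G.Subgraph // M.IsPerfectMatching}, (M.1.edgeSet ∩ cut G X).encard

/-- A leaf of a tree is a vertex of degree one. -/
def IsLeaf {N : Type} (T : SimpleGraph N) (t : N) : Prop :=
  (T.neighborSet t).ncard = 1

/-- A perfect matching decomposition of `G`: a finite cubic tree (every vertex that is not a leaf
has degree three) with a bijection from its leaves to the vertices of `G`. -/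
structure PMDecomposition {V : Type u} (G : SimpleGraph V) where
  node : Type
  finite_node : Finite node
  tree : SimpleGraph node
  isTree : tree.IsTree
  cubic : ∀ t : node, IsLeaf tree t ∨ (tree.neighborSet t).ncard = 3
  leafEquiv : {t : node // IsLeaf tree t} ≃ V

/-- For an edge `t₁t₂` of the tree: the vertices of `G` that are mapped to the leaves in the
component of `t₁` after the removal of the edge `t₁t₂`. -/
def PMDecomposition.shore {V : Type u} {G : SimpleGraph V} (D : PMDecomposition G)
    (t₁ t₂ : D.node) : Set V :=
  {v | (D.tree.deleteEdges {s(t₁, t₂)}).Reachable t₁ (D.leafEquiv.symm v).1}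

/-- The width of a decomposition: the maximum matching porosity of the cuts induced by the
edges of its tree. -/
noncomputable def PMDecomposition.width {V : Type u} {G : SimpleGraph V}
    (D : PMDecomposition G) : ℕ∞ :=
  ⨆ (t₁ : D.node) (t₂ : D.node) (_ : D.tree.Adj t₁ t₂), matchingPorosity G (D.shore t₁ t₂)

/-- The perfect matching width of `G`: the minimum width of its perfect matching decompositions.
(It is `⊤` only if there is no decomposition; every finite graph with at least two vertices
has one.) -/
noncomputable def pmw {V : Type u} (G : SimpleGraph V) : ℕ∞ :=
  ⨅ D : PMDecomposition G, D.width

/-- `∂(Z)` is a tight cut: every perfect matching meets it in exactly one edge. -/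
def IsTightCut {V : Type u} (G : SimpleGraph V) (Z : Set V) : Prop :=
  ∀ M : G.Subgraph, M.IsPerfectMatching → (M.edgeSet ∩ cut G Z).encard = 1

/-- `∂(Z)` is a tight cut none of whose two shores consists of a single vertex. -/
def IsNontrivialTightCut {V : Type u} (G : SimpleGraph V) (Z : Set V) : Prop :=
  IsTightCut G Z ∧ Z.encard ≠ 1 ∧ Zᶜ.encard ≠ 1

/-- The graph `G_Z` obtained from `G` by identifying `Z` as the single vertex `none`, where loops
and parallel edges are deleted. The vertices outside `Z` are kept. -/
def contract {V : Type u} (G : SimpleGraph V) (Z : Set V) : SimpleGraph (Option ↥Zᶜ) where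
  Adj a b := match a, b with
    | some x, some y => G.Adj x.1 y.1
    | some x, none => ∃ z ∈ Z, G.Adj x.1 z
    | none, some y => ∃ z ∈ Z, G.Adj y.1 z
    | none, none => False
  symm := ⟨by
    rintro (_ | x) (_ | y) h
    · exact h
    · exact h
    · exact h
    · exact G.adj_symm h⟩
  loopless := ⟨by
    rintro (_ | x) h
    · exact h
    · exact G.loopless.irrefl _ h⟩

/-- A brace: a bipartite matching covered graph without nontrivial tight cuts. -/
def IsBrace {V : Type u} (G : SimpleGraph V) : Prop :=
  MatchingCovered G ∧ G.IsBipartite ∧ ∀ Z : Set V, ¬ IsNontrivialTightCut G Z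

/-- A brick: a non-bipartite matching covered graph without nontrivial tight cuts. -/
def IsBrick {V : Type u} (G : SimpleGraph V) : Prop :=
  MatchingCovered G ∧ ¬ G.IsBipartite ∧ ∀ Z : Set V, ¬ IsNontrivialTightCut G Z

/-- `H` is (up to isomorphism) a brick or brace of `G`, that is, a member of the list produced by
a tight cut decomposition procedure of `G`. Such a procedure stops at a brick or brace;
otherwise it chooses a nontrivial tight cut and continues with both of its contractions.
(`Z` below is either shore of the chosen cut.) -/
inductive IsBrickOrBraceOf {W : Type w} (H : SimpleGraph W) :
    ∀ {V : Type u}, SimpleGraph V → Prop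
  | base {V : Type u} {G : SimpleGraph V} :
      IsBrick G ∨ IsBrace G → Nonempty (H ≃g G) → IsBrickOrBraceOf H G
  | step {V : Type u} {G : SimpleGraph V} (Z : Set V) :
      IsNontrivialTightCut G Z → IsBrickOrBraceOf H (contract G Z) → IsBrickOrBraceOf H G

end PMWidth

/-! The contractions leading from `G` to `H` compose to a map `f` from `V` to `W`, and tightness
lets every perfect matching of `H` lift to one of `G`: in each fibre exactly one vertex is matched
outside, and all others stay inside (`IsBrickOrBraceOf.exists_liftsMatchings`). Fix one lifted
matching `m₀`; its outgoing vertices form a section `a` of `f`. Restricting a cubic tree for `G` to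
the leaves of `a` gives a cubic tree for `H` whose shores are preimages under `a` of old shores
(`PMDecomposition.exists_restriction`).

The factor 2 comes from `LiftsMatchings.matchingPorosity_preimage_le`. Let a perfect matching `n` of
`H` lift to `m` with section `b`. Where `a` and `b` lie on the same side of `X` over both ends of a
crossing edge of `n`, its lift in `m` crosses too. Otherwise they differ in some fibre, and by
parity of the part of that fibre in `X`, an edge of `m₀` or `m` inside the fibre crosses. The
charged edges are distinct, so the crossing edges of `n` number at most those of `m₀` plus those of
`m`. -/

namespace PMWidth

/-! ### Perfect matchings as partner functions -/

/-- A perfect matching of `G`, given by the function that maps every vertex to its partner. -/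
def IsPartner {V : Type u} (G : SimpleGraph V) (m : V → V) : Prop :=
  ∀ v, G.Adj v (m v) ∧ m (m v) = v

/-- The edges of the matching given by the partner function `m`. -/
def partnerEdges {V : Type u} (m : V → V) : Set (Sym2 V) :=
  Set.range fun v => s(v, m v)

theorem IsPartner.exists_subgraph {V : Type u} {G : SimpleGraph V} {m : V → V}
    (hm : IsPartner G m) :
    ∃ M : G.Subgraph, M.IsPerfectMatching ∧ M.edgeSet = partnerEdges m := by
  refine ⟨{ verts := Set.univ, Adj := fun x y => m x = y, adj_sub := ?_, edge_vert := ?_,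
            symm := ⟨?_⟩ }, ?_, ?_⟩
  · rintro x y rfl
    exact (hm x).1
  · intros
    trivial
  · rintro x y rfl
    exact (hm x).2
  · rw [SimpleGraph.Subgraph.isPerfectMatching_iff]
    intro v
    exact ⟨m v, rfl, fun y hy => Eq.symm hy⟩
  · ext e
    induction e with | _ x y
    simp only [SimpleGraph.Subgraph.mem_edgeSet, partnerEdges, Set.mem_range]
    constructor
    · rintro rfl
      exact ⟨x, rfl⟩
    · rintro ⟨v, hv⟩
      rcases Sym2.eq_iff.1 hv with ⟨rfl, rfl⟩ | ⟨rfl, rfl⟩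
      · rfl
      · exact (hm v).2

theorem exists_isPartner {V : Type u} {G : SimpleGraph V} {M : G.Subgraph}
    (hM : M.IsPerfectMatching) :
    ∃ m : V → V, IsPartner G m ∧ M.edgeSet = partnerEdges m := by
  have h := SimpleGraph.Subgraph.isPerfectMatching_iff.1 hM
  choose m hm hu using h
  refine ⟨m, fun v => ⟨M.adj_sub (hm v), (hu _ _ (hm v).symm).symm⟩, ?_⟩
  ext e
  induction e with | _ x y
  simp only [SimpleGraph.Subgraph.mem_edgeSet, partnerEdges, Set.mem_range]
  constructor
  · intro hxy
    exact ⟨x, by rw [hu x y hxy]⟩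
  · rintro ⟨v, hv⟩
    rcases Sym2.eq_iff.1 hv with ⟨rfl, rfl⟩ | ⟨rfl, rfl⟩
    · exact hm _
    · exact (hm _).symm

theorem MatchingCovered.exists_isPartner {V : Type u} {G : SimpleGraph V}
    (hG : MatchingCovered G) {x y : V} (hxy : G.Adj x y) : ∃ m, IsPartner G m ∧ m x = y := by
  obtain ⟨M, hM, he⟩ := hG.2 s(x, y) hxy
  obtain ⟨m, hm, hMm⟩ := PMWidth.exists_isPartner hM
  refine ⟨m, hm, ?_⟩
  rw [hMm] at he
  obtain ⟨v, hv⟩ := he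
  rcases Sym2.eq_iff.1 hv with ⟨rfl, rfl⟩ | ⟨rfl, rfl⟩
  · rfl
  · exact (hm _).2

theorem MatchingCovered.exists_isPartner_of_nontrivial {V : Type u} [Nontrivial V]
    {G : SimpleGraph V} (hG : MatchingCovered G) : ∃ m, IsPartner G m := by
  obtain ⟨x⟩ := hG.1.nonempty
  obtain ⟨y, hxy⟩ := hG.1.preconnected.exists_adj_of_nontrivial x
  obtain ⟨m, hm, -⟩ := hG.exists_isPartner hxy
  exact ⟨m, hm⟩

theorem mem_partnerEdges_inter_cut {V : Type u} {G : SimpleGraph V} {m : V → V}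
    (hm : IsPartner G m) {X : Set V} {e : Sym2 V} :
    e ∈ partnerEdges m ∩ cut G X ↔ ∃ v ∈ X, m v ∉ X ∧ e = s(v, m v) := by
  constructor
  · rintro ⟨⟨v, rfl⟩, x, hx, y, hy, -, he⟩
    rcases Sym2.eq_iff.1 he with ⟨rfl, rfl⟩ | ⟨rfl, rfl⟩
    · exact ⟨v, hx, hy, rfl⟩
    · exact ⟨m v, hx, by rwa [(hm v).2], by rw [(hm v).2, Sym2.eq_swap]⟩
  · rintro ⟨v, hv, hmv, rfl⟩
    exact ⟨⟨v, rfl⟩, v, hv, m v, hmv, (hm v).1, rfl⟩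

theorem IsTightCut.exists_unique_crossing {V : Type u} {G : SimpleGraph V} {Z : Set V}
    (hZ : IsTightCut G Z) {m : V → V} (hm : IsPartner G m) :
    ∃ z ∈ Z, m z ∉ Z ∧ ∀ x ∈ Z, m x ∉ Z → x = z := by
  obtain ⟨M, hM, hMm⟩ := hm.exists_subgraph
  have h := hZ M hM
  rw [hMm, Set.encard_eq_one] at h
  obtain ⟨e, he⟩ := h
  obtain ⟨z, hz, hmz, rfl⟩ := (mem_partnerEdges_inter_cut hm).1 (he.ge rfl)
  refine ⟨z, hz, hmz, fun x hx hmx => ?_⟩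
  have h1 : s(x, m x) ∈ partnerEdges m ∩ cut G Z :=
    (mem_partnerEdges_inter_cut hm).2 ⟨x, hx, hmx, rfl⟩
  rw [he] at h1
  rcases Sym2.eq_iff.1 h1 with ⟨rfl, -⟩ | ⟨rfl, -⟩
  · rfl
  · exact absurd hx hmz

theorem IsPartner.encard_le_matchingPorosity {V : Type u} {G : SimpleGraph V} {m : V → V}
    (hm : IsPartner G m) (X : Set V) :
    (partnerEdges m ∩ cut G X).encard ≤ matchingPorosity G X := by
  obtain ⟨M, hM, hMm⟩ := hm.exists_subgraph
  rw [← hMm]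
  exact le_iSup (fun M : {M : G.Subgraph // M.IsPerfectMatching} =>
    (M.1.edgeSet ∩ cut G X).encard) ⟨M, hM⟩

theorem matchingPorosity_le {V : Type u} {G : SimpleGraph V} {X : Set V} {k : ℕ∞}
    (h : ∀ m, IsPartner G m → (partnerEdges m ∩ cut G X).encard ≤ k) :
    matchingPorosity G X ≤ k := by
  refine iSup_le ?_
  rintro ⟨M, hM⟩
  obtain ⟨m, hm, hMm⟩ := exists_isPartner hM
  simpa only [hMm] using h m hm

/-! ### Lifting perfect matchings through tight cut contractions -/

/-- The matching `m` maps to the matching `n` if the fibres of `f` are identified to single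
vertices: `a w` is the only vertex of the fibre of `w` that `m` matches to another fibre. -/
structure IsLift {V : Type u} {W : Type w} (f : V → W) (m : V → V) (n : W → W)
    (a : W → V) : Prop where
  section_eq : ∀ w, f (a w) = w
  partner_section : ∀ w, m (a w) = a (n w)
  partner_fiber : ∀ v, v ≠ a (f v) → f (m v) = f v

/-- Every perfect matching of `H` lifts along `f` to a perfect matching of `G`. -/
def LiftsMatchings {V : Type u} {W : Type w} (G : SimpleGraph V) (H : SimpleGraph W)
    (f : V → W) : Prop :=
  ∀ n, IsPartner H n → ∃ m a, IsPartner G m ∧ IsLift f m n a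

/-- A vertex off the composite section either is off `a`, and its partner stays in its `f`-fibre, or
is the `a`-vertex over a point off `b`, whose partner under `n` stays in the same `g`-fibre. -/
theorem LiftsMatchings.comp {V V' : Type u} {W : Type w} {G : SimpleGraph V}
    {G' : SimpleGraph V'} {H : SimpleGraph W} {f : V → V'} {g : V' → W}
    (hg : LiftsMatchings G' H g) (hf : LiftsMatchings G G' f) : LiftsMatchings G H (g ∘ f) := by
  intro p hp
  obtain ⟨n, b, hn, hb⟩ := hg p hp
  obtain ⟨m, a, hm, ha⟩ := hf n hn
  refine ⟨m, a ∘ b, hm, ⟨fun w => ?_, fun w => ?_, fun v hv => ?_⟩⟩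
  · simp [ha.section_eq, hb.section_eq]
  · simp [ha.partner_section, hb.partner_section]
  · by_cases h : v = a (f v)
    · have h1 : f (m v) = n (f v) := by
        conv_lhs => rw [h, ha.partner_section, ha.section_eq]
      simp only [Function.comp_apply, h1]
      refine hb.partner_fiber _ fun h2 => hv ?_
      simp only [Function.comp_apply, ← h2]
      exact h
    · simp [ha.partner_fiber v h]

theorem liftsMatchings_of_iso {V : Type u} {W : Type w} {G : SimpleGraph V} {H : SimpleGraph W}
    (e : H ≃g G) : LiftsMatchings G H e.symm := by
  intro n hn
  refine ⟨fun v => e (n (e.symm v)), e, fun v => ⟨?_, ?_⟩, ⟨?_, ?_, ?_⟩⟩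
  · have h := e.map_adj_iff.2 (hn (e.symm v)).1
    simpa using h
  · simp [(hn _).2]
  · simp
  · simp
  · simp

open Classical in
/-- The map that identifies `Z` to a single vertex. -/
noncomputable def contractMap {V : Type u} (Z : Set V) (v : V) : Option ↥Zᶜ :=
  if h : v ∈ Z then none else some ⟨v, h⟩

theorem contractMap_of_mem {V : Type u} {Z : Set V} {v : V} (h : v ∈ Z) :
    contractMap Z v = none := by
  simp [contractMap, h]

theorem contractMap_of_notMem {V : Type u} {Z : Set V} {v : V} (h : v ∉ Z) :
    contractMap Z v = some ⟨v, h⟩ := by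
  simp [contractMap, h]

theorem contract_adj_contractMap {V : Type u} {G : SimpleGraph V} {Z : Set V} {x y : V}
    (hxy : G.Adj x y) (h : ¬ (x ∈ Z ∧ y ∈ Z)) :
    (contract G Z).Adj (contractMap Z x) (contractMap Z y) := by
  by_cases hx : x ∈ Z
  · have hy : y ∉ Z := fun hy => h ⟨hx, hy⟩
    rw [contractMap_of_mem hx, contractMap_of_notMem hy]
    exact ⟨x, hx, hxy.symm⟩
  · rw [contractMap_of_notMem hx]
    by_cases hy : y ∈ Z
    · rw [contractMap_of_mem hy]
      exact ⟨y, hy, hxy⟩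
    · rw [contractMap_of_notMem hy]
      exact hxy

theorem exists_adj_of_contract_adj {V : Type u} {G : SimpleGraph V} {Z : Set V}
    {a b : Option ↥Zᶜ} (h : (contract G Z).Adj a b) :
    ∃ x y, G.Adj x y ∧ ¬ (x ∈ Z ∧ y ∈ Z) ∧ contractMap Z x = a ∧ contractMap Z y = b := by
  rcases a with _ | x <;> rcases b with _ | y
  · exact h.elim
  · obtain ⟨z, hz, hyz⟩ := h
    exact ⟨z, y, hyz.symm, fun h => y.2 h.2, contractMap_of_mem hz, contractMap_of_notMem y.2⟩
  · obtain ⟨z, hz, hxz⟩ := h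
    exact ⟨x, z, hxz, fun h => x.2 h.1, contractMap_of_notMem x.2, contractMap_of_mem hz⟩
  · exact ⟨x, y, h, fun h => x.2 h.1, contractMap_of_notMem x.2, contractMap_of_notMem y.2⟩

/-- The edge of `n` at the contracted vertex comes from an edge of `G` at some `z ∈ Z`. A perfect
matching through that edge crosses the tight cut nowhere else, so it matches the rest of `Z` within
`Z` and can be glued to `n`. -/
theorem liftsMatchings_contract {V : Type u} {G : SimpleGraph V} {Z : Set V}
    (hG : MatchingCovered G) (hZ : IsTightCut G Z) :
    LiftsMatchings G (contract G Z) (contractMap Z) := by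
  classical
  intro n hn
  have h0 := (hn none).1
  obtain ⟨x₀, hx₀⟩ : ∃ x, n none = some x := by
    cases h : n none with
    | none => exact absurd h0 (by rw [h]; exact (contract G Z).loopless.irrefl _)
    | some x => exact ⟨x, rfl⟩
  rw [hx₀] at h0
  obtain ⟨z, hz, hxz⟩ := h0
  obtain ⟨m, hm, hmz⟩ := hG.exists_isPartner hxz.symm
  obtain ⟨z', hz', hmz', huniq⟩ := hZ.exists_unique_crossing hm
  obtain rfl : z = z' := huniq z hz (by rw [hmz]; exact x₀.2)
  have hstay : ∀ v ∈ Z, v ≠ z → m v ∈ Z := fun v hv hne => by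
    by_contra h
    exact hne (huniq v hv h)
  set a : Option ↥Zᶜ → V := fun o => o.elim z (fun x => x.1) with ha
  have hsec : ∀ o, contractMap Z (a o) = o := by
    rintro (_ | x)
    · exact contractMap_of_mem hz
    · exact contractMap_of_notMem x.2
  have haZ : ∀ v, v ∉ Z → a (contractMap Z v) = v := fun v hv => by
    rw [contractMap_of_notMem hv]; rfl
  have hadj : ∀ o, G.Adj (a o) (a (n o)) := by
    rintro (_ | x)
    · rw [hx₀]
      exact hxz.symm
    · have h := (hn (some x)).1
      cases hy : n (some x) with
      | none =>
        have h1 := (hn (some x)).2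
        rw [hy, hx₀, Option.some.injEq] at h1
        subst h1
        exact hxz
      | some y =>
        rw [hy] at h
        exact h
  -- Inside `Z` away from `z` use `m`; elsewhere copy `n`, with `z` standing for the contracted
  -- vertex.
  refine ⟨fun v => if v ∈ Z ∧ v ≠ z then m v else a (n (contractMap Z v)), a, fun v => ?_,
    ⟨hsec, fun o => ?_, fun v hv => ?_⟩⟩
  · by_cases h : v ∈ Z ∧ v ≠ z
    · have h1 : m v ∈ Z ∧ m v ≠ z := by
        refine ⟨hstay v h.1 h.2, fun h2 => ?_⟩
        have h3 := (hm v).2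
        rw [h2, hmz] at h3
        exact x₀.2 (h3 ▸ h.1)
      simp only [if_pos h, if_pos h1]
      exact hm v
    · have hv : a (contractMap Z v) = v := by
        by_cases hvZ : v ∈ Z
        · obtain rfl : v = z := by tauto
          rw [contractMap_of_mem hvZ]; rfl
        · exact haZ v hvZ
      have h2 : ∀ o, ¬ (a o ∈ Z ∧ a o ≠ z) := by
        rintro (_ | x)
        · exact fun h => h.2 rfl
        · exact fun h => x.2 h.1
      simp only [if_neg h, if_neg (h2 _)]
      rw [hsec, (hn _).2, hv]
      refine ⟨?_, rfl⟩
      have h3 := hadj (contractMap Z v)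
      rwa [hv] at h3
  · have h2 : ¬ (a o ∈ Z ∧ a o ≠ z) := by
      rcases o with _ | x
      · exact fun h => h.2 rfl
      · exact fun h => x.2 h.1
    simp only [if_neg h2, hsec]
  · have hvZ : v ∈ Z := by
      by_contra h
      exact hv (haZ v h).symm
    have hvz : v ≠ z := by
      rintro rfl
      exact hv (by rw [contractMap_of_mem hvZ]; rfl)
    simp only [if_pos (And.intro hvZ hvz)]
    rw [contractMap_of_mem hvZ, contractMap_of_mem (hstay v hvZ hvz)]

/-- Exactly one matching edge leaves `Z`, so after discarding the edges inside `Z` the contracted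
vertex has exactly one partner. This is what keeps contractions matching covered. -/
theorem IsTightCut.exists_isPartner_contract {V : Type u} {G : SimpleGraph V} {Z : Set V}
    (hZ : IsTightCut G Z) {m : V → V} (hm : IsPartner G m) :
    ∃ n, IsPartner (contract G Z) n ∧
      ∀ v, ¬ (v ∈ Z ∧ m v ∈ Z) → n (contractMap Z v) = contractMap Z (m v) := by
  obtain ⟨z, hz, hmz, huniq⟩ := hZ.exists_unique_crossing hm
  set a : Option ↥Zᶜ → V := fun o => o.elim z (fun x => x.1) with ha
  have hsec : ∀ o, contractMap Z (a o) = o := by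
    rintro (_ | x)
    · exact contractMap_of_mem hz
    · exact contractMap_of_notMem x.2
  have ha' : ∀ v, ¬ (v ∈ Z ∧ m v ∈ Z) → a (contractMap Z v) = v := fun v hv => by
    by_cases hvZ : v ∈ Z
    · rw [contractMap_of_mem hvZ]
      exact (huniq v hvZ fun h => hv ⟨hvZ, h⟩).symm
    · rw [contractMap_of_notMem hvZ]; rfl
  have hcross : ∀ o, ¬ (a o ∈ Z ∧ m (a o) ∈ Z) := by
    rintro (_ | x)
    · exact fun h => hmz h.2
    · exact fun h => x.2 h.1
  refine ⟨fun o => contractMap Z (m (a o)), fun o => ⟨?_, ?_⟩, fun v hv => ?_⟩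
  · have h := contract_adj_contractMap (hm (a o)).1 (hcross o)
    rwa [hsec] at h
  · have h1 : ¬ (m (a o) ∈ Z ∧ m (m (a o)) ∈ Z) := by
      rw [(hm _).2]
      exact fun h => hcross o h.symm
    simp only
    rw [ha' _ h1, (hm _).2, hsec]
  · simp only
    rw [ha' v hv]

theorem MatchingCovered.contract {V : Type u} {G : SimpleGraph V} {Z : Set V}
    (hG : MatchingCovered G) (hZ : IsTightCut G Z) (hne : Z.Nonempty) :
    MatchingCovered (contract G Z) := by
  have hsurj : Function.Surjective (contractMap Z) := by
    rintro (_ | x)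
    · obtain ⟨z, hz⟩ := hne
      exact ⟨z, contractMap_of_mem hz⟩
    · exact ⟨x, contractMap_of_notMem x.2⟩
  refine ⟨?_, ?_⟩
  · have : Nonempty (Option ↥Zᶜ) := ⟨none⟩
    refine ⟨fun a b => ?_⟩
    obtain ⟨x, rfl⟩ := hsurj a
    obtain ⟨y, rfl⟩ := hsurj b
    have hxy := hG.1.preconnected x y
    rw [SimpleGraph.reachable_iff_reflTransGen] at hxy
    induction hxy with
    | refl => exact SimpleGraph.Reachable.refl _
    | @tail b c _ hbc ih =>
      by_cases h : b ∈ Z ∧ c ∈ Z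
      · rw [contractMap_of_mem h.2, ← contractMap_of_mem h.1]
        exact ih
      · exact ih.trans (contract_adj_contractMap hbc h).reachable
  · intro e he
    induction e with | _ a b
    obtain ⟨x, y, hxy, hZxy, rfl, rfl⟩ := exists_adj_of_contract_adj he
    obtain ⟨m, hm, rfl⟩ := hG.exists_isPartner hxy
    obtain ⟨n, hn, hnm⟩ := hZ.exists_isPartner_contract hm
    obtain ⟨M, hM, hMn⟩ := hn.exists_subgraph
    refine ⟨M, hM, ?_⟩
    rw [hMn]
    exact ⟨contractMap Z x, by simp only [hnm x hZxy]⟩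

theorem IsBrickOrBraceOf.exists_liftsMatchings {V : Type u} {W : Type w} {G : SimpleGraph V}
    {H : SimpleGraph W} (hH : IsBrickOrBraceOf H G) (hG : MatchingCovered G) [Nontrivial V] :
    ∃ f : V → W, LiftsMatchings G H f ∧ (∃ n, IsPartner H n) ∧ Nontrivial W := by
  revert hG ‹Nontrivial V›
  induction hH with
  | base _ he =>
    intro hG _
    obtain ⟨e⟩ := he
    refine ⟨e.symm, liftsMatchings_of_iso e, ?_, e.toEquiv.nontrivial⟩
    obtain ⟨m, hm⟩ := hG.exists_isPartner_of_nontrivial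
    obtain ⟨n, -, hn, -⟩ := liftsMatchings_of_iso e.symm m hm
    exact ⟨n, hn⟩
  | step Z hZ _ ih =>
    intro hG _
    obtain ⟨m, hm⟩ := hG.exists_isPartner_of_nontrivial
    obtain ⟨z, hz, hmz, -⟩ := hZ.1.exists_unique_crossing hm
    -- The partner of `z` outside `Z` survives as a second vertex. Nontriviality is carried along
    -- because it is what guarantees a perfect matching.
    have : Nontrivial (Option ↥Zᶜ) := ⟨none, some ⟨m z, hmz⟩, by simp⟩
    obtain ⟨g, hg, hn, hW⟩ := ih (hG.contract hZ.1 ⟨z, hz⟩)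
    exact ⟨g ∘ contractMap Z, hg.comp (liftsMatchings_contract hG hZ.1), hn, hW⟩

/-! ### Parity in fibres and porosity of pulled-back cuts -/

open Classical in
theorem even_card_of_involution {V : Type u} (S : Finset V) (m : V → V)
    (hm : ∀ v ∈ S, m v ∈ S ∧ m v ≠ v ∧ m (m v) = v) : Even S.card := by
  have h := Finset.sum_involution (s := S) (f := fun _ => (1 : ZMod 2)) (fun v _ => m v)
    (fun _ _ => by decide) (fun v hv _ => (hm v hv).2.1) (fun v hv => (hm v hv).1)
    (fun v hv => (hm v hv).2.2)
  rw [Finset.sum_const, nsmul_one, ZMod.natCast_eq_zero_iff_even] at h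
  exact h

/-- If no matching edge inside a fibre crosses `X`, then the section chooses the side of `X` on
which the fibre is odd. -/
theorem IsLift.mem_iff_odd {V : Type u} [Finite V] {W : Type w} {G : SimpleGraph V} {f : V → W}
    {m : V → V} {n : W → W} {a : W → V} (hm : IsPartner G m) (h : IsLift f m n a) (X : Set V)
    (x : W) (hx : ∀ v ∈ X, f v = x → f (m v) = x → m v ∈ X) :
    a x ∈ X ↔ Odd ({v | f v = x ∧ v ∈ X}.ncard) := by
  classical
  have := Fintype.ofFinite V
  set S : Finset V := Finset.univ.filter fun v => f v = x ∧ v ∈ X ∧ v ≠ a x with hS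
  have heven : Even S.card := by
    refine even_card_of_involution S m fun v hv => ?_
    simp only [hS, Finset.mem_filter, Finset.mem_univ, true_and] at hv ⊢
    obtain ⟨rfl, hvX, hva⟩ := hv
    have hf := h.partner_fiber v hva
    -- Partners of section vertices are section vertices, so a vertex off the section cannot be
    -- matched to `a x` within its own fibre.
    refine ⟨⟨hf, hx v hvX rfl hf, fun hma => ?_⟩, (hm v).1.ne', (hm v).2⟩
    have h1 := h.partner_section (f v)
    rw [← hma, (hm v).2] at h1
    apply hva
    have h2 := congrArg f h1
    rw [h.section_eq] at h2
    rw [h1]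
    congr 1
    rw [h.section_eq, ← h2]
  by_cases hax : a x ∈ X
  · have : {v | f v = x ∧ v ∈ X} = (insert (a x) S : Finset V) := by
      ext v
      by_cases hva : v = a x
      · simp [hva, hax, h.section_eq]
      · simp [hS, hva]
    rw [this, Set.ncard_coe_finset, Finset.card_insert_of_notMem (by simp [hS])]
    exact iff_of_true hax heven.add_one
  · have : {v | f v = x ∧ v ∈ X} = (S : Set V) := by
      ext v
      by_cases hva : v = a x
      · simp [hS, hva, hax]
      · simp [hS, hva]
    rw [this, Set.ncard_coe_finset]
    exact iff_of_false hax (Nat.not_odd_iff_even.2 heven)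

/-- The parity of the part of the fibre in `X` does not depend on the matching. If neither matching
crosses `X` inside the fibre, this parity fixes the side of both sections. -/
theorem mem_cut_fiber_or {V : Type u} [Finite V] {W : Type w} {G : SimpleGraph V} {f : V → W}
    {m m' : V → V} {n n' : W → W} {a b : W → V} (hm : IsPartner G m) (h : IsLift f m n a)
    (hm' : IsPartner G m') (h' : IsLift f m' n' b) (X : Set V) (x : W) :
    (a x ∈ X ↔ b x ∈ X) ∨
      ∃ e ∈ (partnerEdges m ∩ cut G X) ∪ (partnerEdges m' ∩ cut G X), ∀ v ∈ e, f v = x := by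
  by_cases h1 : ∀ v ∈ X, f v = x → f (m v) = x → m v ∈ X
  · by_cases h2 : ∀ v ∈ X, f v = x → f (m' v) = x → m' v ∈ X
    · left
      rw [h.mem_iff_odd hm X x h1, h'.mem_iff_odd hm' X x h2]
    · push Not at h2
      obtain ⟨v, hv, hx, hx', hmv⟩ := h2
      refine Or.inr ⟨s(v, m' v), Or.inr ((mem_partnerEdges_inter_cut hm').2 ⟨v, hv, hmv, rfl⟩), ?_⟩
      simp [hx, hx']
  · push Not at h1
    obtain ⟨v, hv, hx, hx', hmv⟩ := h1
    refine Or.inr ⟨s(v, m v), Or.inl ((mem_partnerEdges_inter_cut hm).2 ⟨v, hv, hmv, rfl⟩), ?_⟩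
    simp [hx, hx']

/-- If the section `a` comes from one lifted perfect matching, then pulling back a cut along `a`
at most doubles its matching porosity. -/
theorem LiftsMatchings.matchingPorosity_preimage_le {V : Type u} [Finite V] {W : Type w}
    {G : SimpleGraph V} {H : SimpleGraph W} {f : V → W} (hf : LiftsMatchings G H f)
    {m₀ : V → V} {n₀ : W → W} {a : W → V} (hm₀ : IsPartner G m₀) (ha : IsLift f m₀ n₀ a)
    (X : Set V) : matchingPorosity H (a ⁻¹' X) ≤ 2 * matchingPorosity G X := by
  refine matchingPorosity_le fun n hn => ?_
  obtain ⟨m, b, hm, hb⟩ := hf n hn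
  -- Charge each crossing edge `E` of `n` to a crossing edge of `m₀` or `m` lying over the ends of
  -- `E`.
  have key : ∀ E ∈ partnerEdges n ∩ cut H (a ⁻¹' X),
      ∃ e ∈ (partnerEdges m₀ ∩ cut G X) ∪ (partnerEdges m ∩ cut G X), ∀ v ∈ e, f v ∈ E := by
    intro E hE
    obtain ⟨x, hx, hy, rfl⟩ := (mem_partnerEdges_inter_cut hn).1 hE
    rcases mem_cut_fiber_or hm₀ ha hm hb X x with h1 | ⟨e, he, hfe⟩
    · rcases mem_cut_fiber_or hm₀ ha hm hb X (n x) with h2 | ⟨e, he, hfe⟩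
      · have hbx : b x ∈ X := h1.1 hx
        have hby : m (b x) ∉ X := by
          rw [hb.partner_section]
          exact fun h => hy (h2.2 h)
        refine ⟨s(b x, m (b x)),
          Or.inr ((mem_partnerEdges_inter_cut hm).2 ⟨b x, hbx, hby, rfl⟩), ?_⟩
        simp [hb.partner_section, hb.section_eq]
      · exact ⟨e, he, fun v hv => by simp [hfe v hv]⟩
    · exact ⟨e, he, fun v hv => by simp [hfe v hv]⟩
  rcases isEmpty_or_nonempty V with hV | ⟨⟨v₀⟩⟩
  · have : IsEmpty W := ⟨fun x => hV.false (a x)⟩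
    simp [Set.eq_empty_of_isEmpty]
  have : Nonempty (Sym2 V) := ⟨s(v₀, v₀)⟩
  choose! φ hφ hφf using key
  -- An end of the charged edge projects to an end of `E`, and a vertex of `H` determines its
  -- matching edge.
  have hinj : Set.InjOn φ (partnerEdges n ∩ cut H (a ⁻¹' X)) := by
    intro E hE E' hE' heq
    have h1 := hφf E hE
    have h2 := hφf E' hE'
    rw [← heq] at h2
    obtain ⟨v, hv⟩ : ∃ v, v ∈ φ E := by
      induction φ E with | _ x y
      exact ⟨x, by simp⟩
    have hdet : ∀ E ∈ partnerEdges n, ∀ x ∈ E, E = s(x, n x) := by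
      rintro _ ⟨y, rfl⟩ x hx
      rcases Sym2.mem_iff.1 hx with rfl | rfl
      · rfl
      · simp only [(hn y).2, Sym2.eq_swap]
    rw [hdet E hE.1 _ (h1 v hv), hdet E' hE'.1 _ (h2 v hv)]
  calc _ ≤ _ := Set.encard_le_encard_of_injOn hφ hinj
    _ ≤ _ := Set.encard_union_le _ _
    _ ≤ matchingPorosity G X + matchingPorosity G X :=
      add_le_add (hm₀.encard_le_matchingPorosity X) (hm.encard_le_matchingPorosity X)
    _ = _ := (two_mul _).symm

/-! ### Sides of tree edges -/

/-- The vertices of the component of `t₁` after the removal of the edge `t₁t₂`. -/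
def side {N : Type} (T : SimpleGraph N) (t₁ t₂ : N) : Set N :=
  {t | (T.deleteEdges {s(t₁, t₂)}).Reachable t₁ t}

theorem mem_side_self {N : Type} (T : SimpleGraph N) (t₁ t₂ : N) : t₁ ∈ side T t₁ t₂ :=
  SimpleGraph.Reachable.refl _

theorem mem_side_of_adj {N : Type} {T : SimpleGraph N} {t₁ t₂ s t : N} (hs : s ∈ side T t₁ t₂)
    (hst : T.Adj s t) (hne : s(s, t) ≠ s(t₁, t₂)) : t ∈ side T t₁ t₂ :=
  SimpleGraph.Reachable.trans hs
    (SimpleGraph.deleteEdges_adj.2 ⟨hst, hne⟩ : (T.deleteEdges {s(t₁, t₂)}).Adj s t).reachable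

/-- A set that contains `t₁` and is closed under the edges other than `t₁t₂` contains the
component of `t₁`. -/
theorem side_subset {N : Type} {T : SimpleGraph N} {t₁ t₂ : N} {C : Set N} (h₁ : t₁ ∈ C)
    (hC : ∀ s ∈ C, ∀ t, T.Adj s t → s(s, t) ≠ s(t₁, t₂) → t ∈ C) : side T t₁ t₂ ⊆ C := by
  intro t ht
  have ht' := (SimpleGraph.reachable_iff_reflTransGen _ _).1 ht
  induction ht' with
  | refl => exact h₁
  | @tail b c hb hbc ih =>
    have h := SimpleGraph.deleteEdges_adj.1 hbc
    exact hC b (ih ((SimpleGraph.reachable_iff_reflTransGen _ _).2 hb)) c h.1 h.2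

/-- Connectedness makes the two sides cover the tree; the edge being a bridge makes them disjoint.
-/
theorem side_compl {N : Type} {T : SimpleGraph N} (hT : T.IsTree) {t₁ t₂ : N}
    (h : T.Adj t₁ t₂) : (side T t₁ t₂)ᶜ = side T t₂ t₁ := by
  ext t
  constructor
  · intro ht
    have hr := (SimpleGraph.reachable_iff_reflTransGen _ _).1 (hT.connected.preconnected t₁ t)
    have : t ∈ side T t₁ t₂ ∪ side T t₂ t₁ := by
      induction hr with
      | refl => exact Or.inl (mem_side_self _ _ _)
      | @tail b c _ hbc ih =>
        by_cases hc : c ∈ side T t₁ t₂ ∪ side T t₂ t₁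
        · exact hc
        · rcases ih (fun hb => hc (by
            by_contra hc'
            have hE : s(b, c) = s(t₁, t₂) := by
              by_contra hne
              exact hc' (Or.inl (mem_side_of_adj hb hbc hne))
            rcases Sym2.eq_iff.1 hE with ⟨-, rfl⟩ | ⟨-, rfl⟩
            · exact hc' (Or.inr (mem_side_self _ _ _))
            · exact hc' (Or.inl (mem_side_self _ _ _)))) with hb | hb
          · by_cases hE : s(b, c) = s(t₁, t₂)
            · rcases Sym2.eq_iff.1 hE with ⟨-, rfl⟩ | ⟨-, rfl⟩
              · exact Or.inr (mem_side_self _ _ _)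
              · exact Or.inl (mem_side_self _ _ _)
            · exact Or.inl (mem_side_of_adj hb hbc hE)
          · by_cases hE : s(b, c) = s(t₂, t₁)
            · rcases Sym2.eq_iff.1 hE with ⟨-, rfl⟩ | ⟨-, rfl⟩
              · exact Or.inl (mem_side_self _ _ _)
              · exact Or.inr (mem_side_self _ _ _)
            · exact Or.inr (mem_side_of_adj hb hbc hE)
    exact this.resolve_left ht
  · intro ht ht'
    have hb := SimpleGraph.isAcyclic_iff_forall_adj_isBridge.1 hT.isAcyclic h
    rw [SimpleGraph.isBridge_iff] at hb
    have ht2 : (T.deleteEdges {s(t₂, t₁)}).Reachable t₂ t := ht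
    rw [Sym2.eq_swap] at ht2
    exact hb (SimpleGraph.Reachable.trans ht' ht2.symm)

/-- The edge `s₁s₂` does not lie within the side of `t₁`, so no walk inside that side can use it. -/
theorem side_subset_side {N : Type} {T : SimpleGraph N} {t₁ t₂ s₁ s₂ : N}
    (h₁ : t₁ ∈ side T s₁ s₂) (hs : s₁ ∉ side T t₁ t₂ ∨ s₂ ∉ side T t₁ t₂) :
    side T t₁ t₂ ⊆ side T s₁ s₂ := by
  have : side T t₁ t₂ ⊆ {t | t ∈ side T t₁ t₂ ∧ t ∈ side T s₁ s₂} := by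
    refine side_subset ⟨mem_side_self _ _ _, h₁⟩ ?_
    rintro s ⟨hs₁, hs₂⟩ t hst hne
    have ht := mem_side_of_adj hs₁ hst hne
    refine ⟨ht, mem_side_of_adj hs₂ hst fun hE => ?_⟩
    rcases Sym2.eq_iff.1 hE with ⟨rfl, rfl⟩ | ⟨rfl, rfl⟩ <;> tauto
  exact fun t ht => (this ht).2

/-- The components that avoid a fixed node `ρ` form a laminar family. -/
theorem side_laminar {N : Type} {T : SimpleGraph N} (hT : T.IsTree) {t₁ t₂ s₁ s₂ ρ : N}
    (ht : T.Adj t₁ t₂) (hs : T.Adj s₁ s₂) (hρt : ρ ∉ side T t₁ t₂) (hρs : ρ ∉ side T s₁ s₂) :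
    side T t₁ t₂ ⊆ side T s₁ s₂ ∨ side T s₁ s₂ ⊆ side T t₁ t₂ ∨
      Disjoint (side T t₁ t₂) (side T s₁ s₂) := by
  by_cases h : s₁ ∉ side T t₁ t₂ ∨ s₂ ∉ side T t₁ t₂
  · by_cases h₁ : t₁ ∈ side T s₁ s₂
    · exact Or.inl (side_subset_side h₁ h)
    · have h₁' : t₁ ∈ side T s₂ s₁ := by rwa [← side_compl hT hs]
      have := side_subset_side h₁' h.symm
      rw [← side_compl hT hs] at this
      exact Or.inr (Or.inr (Set.disjoint_left.2 fun t ht => this ht))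
  · push Not at h
    have h' : s₁ ∉ side T t₂ t₁ ∨ s₂ ∉ side T t₂ t₁ := by
      rw [← side_compl hT ht]
      exact Or.inl (not_not.2 h.1)
    -- Here the whole complement of the first side would lie in the second, together with `ρ`; this
    -- is where avoiding `ρ` matters.
    by_cases h₂ : t₂ ∈ side T s₁ s₂
    · have := side_subset_side h₂ h'
      rw [← side_compl hT ht] at this
      exact absurd (this hρt) hρs
    · have h₂' : t₂ ∈ side T s₂ s₁ := by rwa [← side_compl hT hs]
      have := side_subset_side h₂' h'.symm
      rw [← side_compl hT ht, ← side_compl hT hs] at this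
      exact Or.inr (Or.inl (Set.compl_subset_compl.1 this))

theorem side_subset_side_of_adj {N : Type} {T : SimpleGraph N} (hT : T.IsTree) {t₁ t₂ x : N}
    (ht : T.Adj t₁ t₂) (hx : T.Adj t₁ x) (hne : x ≠ t₂) : side T x t₁ ⊆ side T t₁ t₂ := by
  refine side_subset_side (mem_side_of_adj (mem_side_self _ _ _) hx ?_) (Or.inl ?_)
  · intro hE
    rcases Sym2.eq_iff.1 hE with ⟨-, h⟩ | ⟨h, -⟩
    · exact hne h
    · exact ht.ne h
  · rw [← side_compl hT hx]
    exact not_not.2 (mem_side_self _ _ _)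

theorem side_disjoint {N : Type} {T : SimpleGraph N} (hT : T.IsTree) {t x y : N}
    (hx : T.Adj t x) (hy : T.Adj t y) (hne : x ≠ y) : Disjoint (side T x t) (side T y t) := by
  have h := side_subset_side_of_adj hT hy hx hne
  rw [← side_compl hT hy]
  exact Set.disjoint_compl_right_iff_subset.2 h

theorem side_subset_insert {N : Type} {T : SimpleGraph N} {t₁ t₂ : N} :
    side T t₁ t₂ ⊆ insert t₁ (⋃ x ∈ T.neighborSet t₁ \ {t₂}, side T x t₁) := by
  refine side_subset (Set.mem_insert _ _) ?_
  rintro s (rfl | hs) t hst hne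
  · refine Or.inr (Set.mem_biUnion (x := t) ⟨hst, ?_⟩ (mem_side_self _ _ _))
    rintro rfl
    exact hne rfl
  · obtain ⟨x, hx, hs⟩ := Set.mem_iUnion₂.1 hs
    by_cases hE : s(s, t) = s(x, t₁)
    · rcases Sym2.eq_iff.1 hE with ⟨-, rfl⟩ | ⟨-, rfl⟩
      · exact Set.mem_insert _ _
      · exact Or.inr (Set.mem_biUnion hx (mem_side_self _ _ _))
    · exact Or.inr (Set.mem_biUnion hx (mem_side_of_adj hs hst hE))

theorem side_of_isLeaf {N : Type} {T : SimpleGraph N} {t₁ t₂ : N} (h : IsLeaf T t₁)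
    (ht : T.Adj t₁ t₂) : side T t₁ t₂ = {t₁} := by
  obtain ⟨x, hx⟩ := Set.ncard_eq_one.1 h
  obtain rfl : t₂ = x := hx.le ht
  refine Set.Subset.antisymm ?_ (Set.singleton_subset_iff.2 (mem_side_self _ _ _))
  have := side_subset_insert (T := T) (t₁ := t₁) (t₂ := t₂)
  simpa [hx] using this

theorem exists_side_eq_of_ncard_eq_three {N : Type} {T : SimpleGraph N} (hT : T.IsTree)
    {t₁ t₂ : N} (h : (T.neighborSet t₁).ncard = 3) (ht : T.Adj t₁ t₂) :
    ∃ x y, T.Adj x t₁ ∧ T.Adj y t₁ ∧ Disjoint (side T x t₁) (side T y t₁) ∧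
      side T t₁ t₂ = insert t₁ (side T x t₁ ∪ side T y t₁) ∧ t₁ ∉ side T x t₁ ∧
      t₁ ∉ side T y t₁ := by
  have h2 : (T.neighborSet t₁ \ {t₂}).ncard = 2 := by
    rw [Set.ncard_sdiff_singleton_of_mem (show t₂ ∈ T.neighborSet t₁ from ht), h]
  obtain ⟨x, y, hxy, he⟩ := Set.ncard_eq_two.1 h2
  have hx : x ∈ T.neighborSet t₁ \ {t₂} := he.ge (by simp)
  have hy : y ∈ T.neighborSet t₁ \ {t₂} := he.ge (by simp)
  have hnot : ∀ z, T.Adj t₁ z → t₁ ∉ side T z t₁ := fun z hz => by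
    rw [← side_compl hT hz]
    exact not_not.2 (mem_side_self _ _ _)
  refine ⟨x, y, hx.1.symm, hy.1.symm, side_disjoint hT hx.1 hy.1 hxy, ?_, hnot x hx.1,
    hnot y hy.1⟩
  refine Set.Subset.antisymm ?_ ?_
  · have := side_subset_insert (T := T) (t₁ := t₁) (t₂ := t₂)
    simpa [he] using this
  · exact Set.insert_subset (mem_side_self _ _ _)
      (Set.union_subset (side_subset_side_of_adj hT ht hx.1 hx.2)
        (side_subset_side_of_adj hT ht hy.1 hy.2))

theorem exists_isLeaf_mem_side {N : Type} [Finite N] {T : SimpleGraph N} (hT : T.IsTree)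
    (hcubic : ∀ t, IsLeaf T t ∨ (T.neighborSet t).ncard = 3) {t₁ t₂ : N} (ht : T.Adj t₁ t₂) :
    ∃ t ∈ side T t₁ t₂, IsLeaf T t := by
  induction hn : (side T t₁ t₂).ncard using Nat.strong_induction_on generalizing t₁ t₂ with
  | _ n ih =>
    rcases hcubic t₁ with h | h
    · exact ⟨t₁, mem_side_self _ _ _, h⟩
    · obtain ⟨x, y, hx, -, -, he, hnot, -⟩ := exists_side_eq_of_ncard_eq_three hT h ht
      have hsub : side T x t₁ ⊆ side T t₁ t₂ := by
        rw [he]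
        exact fun t ht => Or.inr (Or.inl ht)
      have hlt : (side T x t₁).ncard < n := by
        rw [← hn]
        exact Set.ncard_lt_ncard ⟨hsub, fun h => hnot (h (mem_side_self _ _ _))⟩
      obtain ⟨t, ht, hl⟩ := ih _ hlt hx rfl
      exact ⟨t, hsub ht, hl⟩

/-! ### Cubic trees from laminar families -/

/-- A laminar family whose nontrivial members split into two members comes from a cubic tree. -/
theorem exists_cubic_tree {α : Type} [Finite α] [Nontrivial α] (F : Set (Set α)) (r : α)
    (hne : ∀ X ∈ F, X.Nonempty) (hr : ∀ X ∈ F, r ∉ X)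
    (hlam : ∀ X ∈ F, ∀ Y ∈ F, X ⊆ Y ∨ Y ⊆ X ∨ Disjoint X Y) (htop : {r}ᶜ ∈ F)
    (hsing : ∀ x ≠ r, {x} ∈ F)
    (hsplit : ∀ X ∈ F, X.Nontrivial → ∃ A ∈ F, ∃ B ∈ F, Disjoint A B ∧ A ∪ B = X) :
    ∃ (N : Type) (_ : Finite N) (T : SimpleGraph N) (_ : T.IsTree)
      (_ : ∀ t, IsLeaf T t ∨ (T.neighborSet t).ncard = 3) (e : {t : N // IsLeaf T t} ≃ α),
      ∀ t₁ t₂, T.Adj t₁ t₂ →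
        {x | (e.symm x).1 ∈ side T t₁ t₂} ∈ F ∨ {x | (e.symm x).1 ∈ side T t₁ t₂}ᶜ ∈ F := by
  classical
  set N := {X : Set α // X ∈ F ∨ X = Set.univ} with hN
  let top : N := ⟨Set.univ, Or.inr rfl⟩
  -- The tree is the Hasse diagram of the family with the full set added on top. The top node serves
  -- as the leaf of `r`, and the singletons are the other leaves.
  set T : SimpleGraph N := SimpleGraph.hasse N with hTdef
  have le_top' : ∀ X : N, X ≤ top := fun X => Set.subset_univ X.1
  have mem_of_ne : ∀ X : N, X ≠ top → X.1 ∈ F := fun X hX =>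
    X.2.resolve_right fun h => hX (Subtype.ext h)
  have nonempty' : ∀ X : N, X.1.Nonempty := by
    rintro ⟨X, hX | rfl⟩
    · exact hne X hX
    · exact Set.univ_nonempty
  -- Two members above a common nonempty one meet, so laminarity makes them comparable; hence
  -- parents are unique.
  have chain : ∀ X Y Y' : N, X ≤ Y → X ≤ Y' → Y ≤ Y' ∨ Y' ≤ Y := by
    intro X Y Y' h h'
    by_cases hY : Y = top
    · exact Or.inr (hY ▸ le_top' _)
    by_cases hY' : Y' = top
    · exact Or.inl (hY' ▸ le_top' _)
    rcases hlam _ (mem_of_ne Y hY) _ (mem_of_ne Y' hY') with h1 | h1 | h1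
    · exact Or.inl h1
    · exact Or.inr h1
    · obtain ⟨x, hx⟩ := nonempty' X
      exact absurd (h' hx) (Set.disjoint_left.1 h1 (h hx))
  have covBy_le : ∀ X Y Z : N, X ⋖ Y → X < Z → Y ≤ Z := by
    intro X Y Z hXY hXZ
    rcases chain X Y Z hXY.le hXZ.le with h | h
    · exact h
    · exact (h.lt_or_eq.resolve_left (hXY.2 hXZ)).ge
  have covBy_unique : ∀ X Y Y' : N, X ⋖ Y → X ⋖ Y' → Y = Y' := fun X Y Y' h h' =>
    le_antisymm (covBy_le X Y Y' h h'.lt) (covBy_le X Y' Y h' h.lt)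
  have parent : ∀ X : N, X ≠ top → ∃ P, X ⋖ P := fun X hX => by
    obtain ⟨P, hP, -⟩ := exists_covBy_le_of_lt (lt_of_le_of_ne (le_top' X) hX)
    exact ⟨P, hP⟩
  -- Cutting the edge to the parent separates exactly the down-set of `X`, so every edge is a bridge
  -- and the shores are members of `F`.
  have side_le : ∀ X P : N, X ⋖ P → side T X P = Set.Iic X := by
    intro X P hXP
    refine Set.Subset.antisymm (side_subset (Set.mem_Iic.2 le_rfl) ?_) ?_
    · intro b hb c hbc hE
      have hb : b ≤ X := hb
      rcases hbc with hbc | hbc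
      · rcases hb.lt_or_eq with hlt | rfl
        · exact covBy_le b c X hbc hlt
        · exact absurd (by rw [covBy_unique b c P hbc hXP]) hE
      · exact hbc.le.trans hb
    · intro Z
      induction Z using (wellFounded_gt (α := N)).induction with
      | _ Z ih =>
        intro hZ
        rcases (show Z ≤ X from hZ).lt_or_eq with hlt | rfl
        · obtain ⟨Z', hZZ', hZ'⟩ := exists_covBy_le_of_lt hlt
          refine mem_side_of_adj (ih Z' hZZ'.lt hZ') (Or.inr hZZ') fun hE => ?_
          rcases Sym2.eq_iff.1 hE with ⟨-, h⟩ | ⟨-, h⟩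
          · exact absurd (h ▸ hlt.le) hXP.lt.not_ge
          · exact hlt.ne h
        · exact mem_side_self _ _ _
  have hT : T.IsTree := by
    have : Nonempty N := ⟨top⟩
    refine ⟨⟨?_⟩, ?_⟩
    · have key : ∀ Z : N, T.Reachable top Z := by
        intro Z
        induction Z using (wellFounded_gt (α := N)).induction with
        | _ Z ih =>
          by_cases hZ : Z = top
          · rw [hZ]
          · obtain ⟨P, hP⟩ := parent Z hZ
            exact (ih P hP.lt).trans (SimpleGraph.Adj.reachable (Or.inr hP))
      exact fun X Y => (key X).symm.trans (key Y)
    · rw [SimpleGraph.isAcyclic_iff_forall_adj_isBridge]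
      intro X Y hXY
      have key : ∀ X Y : N, X ⋖ Y → T.IsBridge s(X, Y) := by
        intro X Y h
        rw [SimpleGraph.isBridge_iff]
        intro hreach
        have : Y ∈ side T X Y := hreach
        rw [side_le X Y h] at this
        exact h.lt.not_ge this
      rcases hXY with h | h
      · exact key X Y h
      · rw [Sym2.eq_swap]
        exact key Y X h
  have htop_leaf : IsLeaf T top := by
    refine Set.ncard_eq_one.2 ⟨⟨{r}ᶜ, Or.inl htop⟩, ?_⟩
    have hcov : ∀ Y : N, Y ≠ top → Y ≤ ⟨{r}ᶜ, Or.inl htop⟩ := fun Y hY x hx => by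
      rintro rfl
      exact hr _ (mem_of_ne Y hY) hx
    have hlt : (⟨{r}ᶜ, Or.inl htop⟩ : N) < top :=
      lt_of_le_of_ne (le_top' _) fun h => by
        have h1 : ({r}ᶜ : Set α) = Set.univ := congrArg Subtype.val h
        exact (h1.ge (Set.mem_univ r)) rfl
    ext Y
    constructor
    · rintro (h | h)
      · exact absurd h.lt (le_top' Y).not_gt
      · exact ((hcov Y h.ne).lt_or_eq.resolve_left fun h1 => h.2 h1 hlt)
    · rintro rfl
      exact Or.inr ⟨hlt, fun Z h1 h2 => h1.not_ge (hcov Z h2.ne)⟩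
  have hsing_leaf : ∀ x (hx : x ≠ r), IsLeaf T ⟨{x}, Or.inl (hsing x hx)⟩ := by
    intro x hx
    obtain ⟨P, hP⟩ := parent ⟨{x}, Or.inl (hsing x hx)⟩ fun h =>
      hr _ (hsing x hx) ((congrArg Subtype.val h).ge (Set.mem_univ r))
    refine Set.ncard_eq_one.2 ⟨P, ?_⟩
    ext Y
    constructor
    · rintro (h | h)
      · exact covBy_unique _ _ _ h hP
      · exfalso
        obtain ⟨y, hy⟩ := nonempty' Y
        have hyx : y = x := h.le hy
        exact h.lt.not_ge (Set.singleton_subset_iff.2 (hyx ▸ hy))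
    · rintro rfl
      exact Or.inl hP
  -- The three neighbours are the parent and the two halves of the splitting.
  have hdeg : ∀ X : N, X ≠ top → X.1.Nontrivial → (T.neighborSet X).ncard = 3 := by
    intro X hX hnt
    obtain ⟨P, hP⟩ := parent X hX
    obtain ⟨A, hA, B, hB, hAB, hU⟩ := hsplit X.1 (mem_of_ne X hX) hnt
    let A' : N := ⟨A, Or.inl hA⟩
    let B' : N := ⟨B, Or.inl hB⟩
    have key : ∀ Y : N, Y < X → Y ≤ A' ∨ Y ≤ B' := by
      intro Y hY
      have hYF := mem_of_ne Y (hY.trans_le (le_top' X)).ne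
      by_contra hcon
      push Not at hcon
      -- A member below `X` contained in neither half must contain both by laminarity, and then it
      -- is all of `X`.
      have aux : ∀ C D : Set α, C ∈ F → ¬ Y.1 ⊆ C → ¬ Y.1 ⊆ D → C ∪ D = X.1 → C ⊆ Y.1 := by
        intro C D hC hYC hYD hCD
        rcases hlam _ hYF _ hC with h | h | h
        · exact absurd h hYC
        · exact h
        · exact absurd (fun x hx => (hCD.ge (hY.le hx)).resolve_left
            (Set.disjoint_left.1 h hx)) hYD
      have h1 := aux A B hA hcon.1 hcon.2 hU
      have h2 := aux B A hB hcon.2 hcon.1 (by rw [Set.union_comm, hU])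
      exact hY.not_ge (show X.1 ⊆ Y.1 from hU ▸ Set.union_subset h1 h2)
    have hlt : ∀ C D : N, C.1 ∪ D.1 = X.1 → Disjoint C.1 D.1 → C < X := by
      intro C D hCD hd
      refine lt_of_le_of_ne (show C.1 ⊆ X.1 from hCD ▸ Set.subset_union_left) ?_
      rintro rfl
      obtain ⟨x, hx⟩ := nonempty' D
      exact Set.disjoint_left.1 hd (hCD.le (Or.inr hx)) hx
    have hAX : A' < X := hlt A' B' hU hAB
    have hBX : B' < X := hlt B' A' (by rw [Set.union_comm]; exact hU) hAB.symm
    have hnle : ∀ C D : N, Disjoint C.1 D.1 → ¬ C ≤ D := by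
      intro C D hd h
      obtain ⟨x, hx⟩ := nonempty' C
      exact Set.disjoint_left.1 hd hx (h hx)
    have hAc : A' ⋖ X := ⟨hAX, fun Z h1 h2 => (key Z h2).elim (fun h => h1.not_ge h)
      fun h => hnle A' B' hAB (h1.le.trans h)⟩
    have hBc : B' ⋖ X := ⟨hBX, fun Z h1 h2 => (key Z h2).elim
      (fun h => hnle B' A' hAB.symm (h1.le.trans h)) fun h => h1.not_ge h⟩
    refine Set.ncard_eq_three.2 ⟨P, A', B', (hAX.trans hP.lt).ne', (hBX.trans hP.lt).ne',
      fun h => hnle A' B' hAB h.le, ?_⟩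
    ext Y
    constructor
    · rintro (h | h)
      · exact Or.inl (covBy_unique _ _ _ h hP)
      · rcases key Y h.lt with h1 | h1
        · exact Or.inr (Or.inl (h1.lt_or_eq.resolve_left fun h2 => h.2 h2 hAX))
        · exact Or.inr (Or.inr (h1.lt_or_eq.resolve_left fun h2 => h.2 h2 hBX))
    · rintro (rfl | rfl | rfl)
      · exact Or.inl hP
      · exact Or.inr hAc
      · exact Or.inr hBc
  have hcases : ∀ X : N, X = top ∨ (∃ x, ∃ hx : x ≠ r, X = ⟨{x}, Or.inl (hsing x hx)⟩) ∨
      (T.neighborSet X).ncard = 3 := by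
    intro X
    by_cases hX : X = top
    · exact Or.inl hX
    · rcases (nonempty' X).exists_eq_singleton_or_nontrivial with ⟨x, hx⟩ | h
      · refine Or.inr (Or.inl ⟨x, ?_, Subtype.ext hx⟩)
        rintro rfl
        exact hr _ (mem_of_ne X hX) (hx.ge rfl)
      · exact Or.inr (Or.inr (hdeg X hX h))
  let leaf : α → {t : N // IsLeaf T t} := fun x =>
    if hx : x = r then ⟨top, htop_leaf⟩ else ⟨⟨{x}, Or.inl (hsing x hx)⟩, hsing_leaf x hx⟩
  have leaf_r : (leaf r).1 = top := by simp [leaf]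
  have leaf_ne : ∀ x, x ≠ r → (leaf x).1.1 = {x} := fun x hx => by simp [leaf, hx]
  have leaf_le : ∀ x (X : N), X ≠ top → ((leaf x).1 ≤ X ↔ x ∈ X.1) := by
    intro x X hX
    by_cases hx : x = r
    · subst hx
      rw [leaf_r]
      exact iff_of_false (fun h => hX (le_antisymm (le_top' X) h)) (hr _ (mem_of_ne X hX))
    · change (leaf x).1.1 ⊆ X.1 ↔ _
      rw [leaf_ne x hx, Set.singleton_subset_iff]
  have leaf_bij : Function.Bijective leaf := by
    constructor
    · have aux : ∀ x, x ≠ r → leaf x ≠ leaf r := by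
        intro x hx h
        have h1 : (leaf x).1.1 = (leaf r).1.1 := by rw [h]
        rw [leaf_ne x hx, leaf_r] at h1
        exact hx (h1.ge (Set.mem_univ r)).symm
      intro x y hxy
      by_cases hx : x = r
      · by_contra hne
        subst hx
        exact aux y (Ne.symm hne) hxy.symm
      · by_cases hy : y = r
        · subst hy
          exact absurd hxy (aux x hx)
        · have h1 : (leaf x).1.1 = (leaf y).1.1 := by rw [hxy]
          rw [leaf_ne x hx, leaf_ne y hy] at h1
          exact Set.singleton_injective h1
    · rintro ⟨X, hX⟩
      rcases hcases X with rfl | ⟨x, hx, rfl⟩ | h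
      · exact ⟨r, Subtype.ext leaf_r⟩
      · exact ⟨x, Subtype.ext (Subtype.ext (leaf_ne x hx))⟩
      · exact absurd (hX.symm.trans h) (by decide)
  have hshore : ∀ X P : N, X ⋖ P → {x | (leaf x).1 ∈ side T X P} ∈ F := by
    intro X P h
    have hX : X ≠ top := (h.lt.trans_le (le_top' P)).ne
    have : {x | (leaf x).1 ∈ side T X P} = X.1 := by
      ext x
      rw [side_le X P h]
      exact leaf_le x X hX
    rw [this]
    exact mem_of_ne X hX
  refine ⟨N, inferInstance, T, hT, fun X => ?_, (Equiv.ofBijective leaf leaf_bij).symm, ?_⟩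
  · rcases hcases X with rfl | ⟨x, hx, rfl⟩ | h
    · exact Or.inl htop_leaf
    · exact Or.inl (hsing_leaf x hx)
    · exact Or.inr h
  · intro X Y hXY
    simp only [Equiv.symm_symm, Equiv.ofBijective_apply]
    rcases hXY with h | h
    · exact Or.inl (hshore X Y h)
    · right
      have := hshore Y X h
      rwa [← side_compl hT (Or.inr h : T.Adj X Y)] at this

/-- Restricting a cubic tree to some of its leaves: the new shores are traces of old ones. -/
theorem exists_restricted_cubic_tree {α : Type} [Finite α] [Nontrivial α] {N : Type} [Finite N]
    {T : SimpleGraph N} (hT : T.IsTree) (hcubic : ∀ t, IsLeaf T t ∨ (T.neighborSet t).ncard = 3)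
    {g : α → N} (hg : Function.Injective g) (hleaf : ∀ x, IsLeaf T (g x)) :
    ∃ (N' : Type) (_ : Finite N') (T' : SimpleGraph N') (_ : T'.IsTree)
      (_ : ∀ t, IsLeaf T' t ∨ (T'.neighborSet t).ncard = 3) (e : {t : N' // IsLeaf T' t} ≃ α),
      ∀ t₁ t₂, T'.Adj t₁ t₂ → ∃ s₁ s₂, T.Adj s₁ s₂ ∧
        {x | (e.symm x).1 ∈ side T' t₁ t₂} = g ⁻¹' side T s₁ s₂ := by
  obtain ⟨r⟩ := (inferInstance : Nonempty α)
  -- Traces of sides on the chosen leaves, normalised to avoid a fixed leaf `r`; such a family is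
  -- laminar.
  set F : Set (Set α) :=
    {X | X.Nonempty ∧ r ∉ X ∧ ∃ s₁ s₂, T.Adj s₁ s₂ ∧ X = g ⁻¹' side T s₁ s₂} with hF
  have hnbr : ∀ x, ∃ t, T.Adj (g x) t := fun x => by
    obtain ⟨t, ht⟩ := Set.ncard_eq_one.1 (hleaf x)
    exact ⟨t, ht.ge rfl⟩
  have hpre : ∀ x t, T.Adj (g x) t → g ⁻¹' side T (g x) t = {x} := fun x t ht => by
    rw [side_of_isLeaf (hleaf x) ht]
    ext y
    exact hg.eq_iff
  have hlam : ∀ X ∈ F, ∀ Y ∈ F, X ⊆ Y ∨ Y ⊆ X ∨ Disjoint X Y := by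
    rintro _ ⟨-, hrX, t₁, t₂, ht, rfl⟩ _ ⟨-, hrY, s₁, s₂, hs, rfl⟩
    rcases side_laminar hT ht hs hrX hrY with h | h | h
    · exact Or.inl (Set.preimage_mono h)
    · exact Or.inr (Or.inl (Set.preimage_mono h))
    · exact Or.inr (Or.inr (h.preimage g))
  have htop : {r}ᶜ ∈ F := by
    obtain ⟨t, ht⟩ := hnbr r
    obtain ⟨x, hx⟩ := exists_ne r
    refine ⟨⟨x, hx⟩, fun h => h rfl, t, g r, ht.symm, ?_⟩
    rw [← side_compl hT ht, Set.preimage_compl, hpre r t ht]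
  have hsing : ∀ x ≠ r, {x} ∈ F := by
    intro x hx
    obtain ⟨t, ht⟩ := hnbr x
    exact ⟨⟨x, rfl⟩, fun h => hx h.symm, g x, t, ht, (hpre x t ht).symm⟩
  have hsplit : ∀ X ∈ F, X.Nontrivial → ∃ A ∈ F, ∃ B ∈ F, Disjoint A B ∧ A ∪ B = X := by
    rintro _ ⟨-, hrX, t₁, t₂, ht, rfl⟩ hnt
    -- Descend in the tree until both branches contain a chosen leaf. A branch without one leaves
    -- the trace unchanged, which amounts to suppressing degree-two nodes.
    induction hn : (side T t₁ t₂).ncard using Nat.strong_induction_on generalizing t₁ t₂ with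
    | _ n ih =>
      rcases hcubic t₁ with h | h
      · exfalso
        rw [side_of_isLeaf h ht] at hnt
        obtain ⟨x, hx, y, hy, hxy⟩ := hnt
        exact hxy (hg (Eq.trans hx (Eq.symm hy)))
      · obtain ⟨x, y, hx, hy, hd, heq, hnx, hny⟩ := exists_side_eq_of_ncard_eq_three hT h ht
        have ht₁ : ¬ IsLeaf T t₁ := fun h' => absurd (h'.symm.trans h) (by decide)
        have hU : g ⁻¹' side T x t₁ ∪ g ⁻¹' side T y t₁ = g ⁻¹' side T t₁ t₂ := by
          rw [heq]
          ext z
          constructor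
          · exact fun hz => Or.inr hz
          · rintro (hz | hz)
            · exact absurd (hz ▸ hleaf z) ht₁
            · exact hz
        have hlt : ∀ z, side T z t₁ ⊆ side T t₁ t₂ → t₁ ∉ side T z t₁ →
            (side T z t₁).ncard < n := fun z hz hnz => by
          rw [← hn]
          exact Set.ncard_lt_ncard ⟨hz, fun h => hnz (h (mem_side_self _ _ _))⟩
        have hxs : side T x t₁ ⊆ side T t₁ t₂ := by
          rw [heq]
          exact fun t ht => Or.inr (Or.inl ht)
        have hys : side T y t₁ ⊆ side T t₁ t₂ := by
          rw [heq]
          exact fun t ht => Or.inr (Or.inr ht)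
        rcases (g ⁻¹' side T x t₁).eq_empty_or_nonempty with hxe | hxne
        · rw [hxe, Set.empty_union] at hU
          rw [← hU] at hrX hnt ⊢
          exact ih _ (hlt y hys hny) y t₁ hy hrX hnt rfl
        rcases (g ⁻¹' side T y t₁).eq_empty_or_nonempty with hye | hyne
        · rw [hye, Set.union_empty] at hU
          rw [← hU] at hrX hnt ⊢
          exact ih _ (hlt x hxs hnx) x t₁ hx hrX hnt rfl
        exact ⟨_, ⟨hxne, fun h => hrX (hxs h), x, t₁, hx, rfl⟩,
          _, ⟨hyne, fun h => hrX (hys h), y, t₁, hy, rfl⟩, hd.preimage g, hU⟩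
  obtain ⟨N', hN', T', hT', hc, e, he⟩ := exists_cubic_tree F r (fun X hX => hX.1)
    (fun X hX => hX.2.1) hlam htop hsing hsplit
  refine ⟨N', hN', T', hT', hc, e, fun t₁ t₂ ht => ?_⟩
  rcases he t₁ t₂ ht with ⟨-, -, s₁, s₂, hs, h⟩ | ⟨-, -, s₁, s₂, hs, h⟩
  · exact ⟨s₁, s₂, hs, h⟩
  -- The shore containing `r` is the complement of a member of `F`, hence the trace of the opposite
  -- side.
  · refine ⟨s₂, s₁, hs.symm, ?_⟩
    rw [← side_compl hT hs, Set.preimage_compl, ← h, compl_compl]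

/-! ### Restricting decompositions and the width bound -/

theorem PMDecomposition.exists_restriction {V : Type u} {W : Type w} [Finite W] [Nontrivial W]
    {G : SimpleGraph V} (H : SimpleGraph W) (D : PMDecomposition G) {a : W → V}
    (ha : Function.Injective a) :
    ∃ D' : PMDecomposition H, ∀ t₁ t₂, D'.tree.Adj t₁ t₂ →
      ∃ s₁ s₂, D.tree.Adj s₁ s₂ ∧ D'.shore t₁ t₂ = a ⁻¹' D.shore s₁ s₂ := by
  have := D.finite_node
  -- Tree nodes must live in `Type`, and they are built as sets of vertices, so `W` is first
  -- replaced by `Fin n`.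
  obtain ⟨n, ⟨ε⟩⟩ := Finite.exists_equiv_fin W
  have : Nontrivial (Fin n) := ε.symm.nontrivial
  have hg : Function.Injective fun i => (D.leafEquiv.symm (a (ε.symm i))).1 :=
    Subtype.val_injective.comp (D.leafEquiv.symm.injective.comp (ha.comp ε.symm.injective))
  obtain ⟨N, hN, T, hT, hc, e, he⟩ := exists_restricted_cubic_tree D.isTree D.cubic hg
    fun i => (D.leafEquiv.symm (a (ε.symm i))).2
  refine ⟨⟨N, hN, T, hT, hc, e.trans ε.symm⟩, fun t₁ t₂ ht => ?_⟩
  obtain ⟨s₁, s₂, hs, h⟩ := he t₁ t₂ ht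
  refine ⟨s₁, s₂, hs, ?_⟩
  ext x
  have hx := Set.ext_iff.1 h (ε x)
  simp only [Set.mem_preimage, Set.mem_ofPred_eq, Equiv.symm_apply_apply] at hx
  exact hx

/-- A leaf has a neighbour, and the side across that edge contains another leaf. This excludes the
one-vertex graph, which is matching covered but has no perfect matching. -/
theorem PMDecomposition.nontrivial {V : Type u} [Nonempty V] {G : SimpleGraph V}
    (D : PMDecomposition G) : Nontrivial V := by
  have := D.finite_node
  obtain ⟨v⟩ := (inferInstance : Nonempty V)
  set l := D.leafEquiv.symm v with hl
  obtain ⟨t, ht⟩ := Set.ncard_eq_one.1 l.2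
  have hlt : D.tree.Adj l.1 t := ht.ge rfl
  obtain ⟨l', hl', hleaf⟩ := exists_isLeaf_mem_side D.isTree D.cubic hlt.symm
  rw [← side_compl D.isTree hlt, side_of_isLeaf l.2 hlt] at hl'
  refine ⟨v, D.leafEquiv ⟨l', hleaf⟩, fun h => hl' ?_⟩
  rw [hl, h, Equiv.symm_apply_apply]
  rfl

theorem PMDecomposition.pmw_le {V : Type u} [Finite V] {W : Type w} {G : SimpleGraph V}
    {H : SimpleGraph W} (D : PMDecomposition G) (hG : MatchingCovered G)
    (hH : IsBrickOrBraceOf H G) : pmw H ≤ 2 * D.width := by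
  have := hG.1.nonempty
  have := D.nontrivial
  obtain ⟨f, hf, ⟨n, hn⟩, hW⟩ := hH.exists_liftsMatchings hG
  obtain ⟨m, a, hm, ha⟩ := hf n hn
  have hinj : Function.Injective a := Function.LeftInverse.injective ha.section_eq
  have := Finite.of_injective a hinj
  obtain ⟨D', hD'⟩ := D.exists_restriction H hinj
  refine (iInf_le _ D').trans (iSup_le fun t₁ => iSup_le fun t₂ => iSup_le fun ht => ?_)
  obtain ⟨s₁, s₂, hs, h⟩ := hD' t₁ t₂ ht
  rw [h]
  refine (hf.matchingPorosity_preimage_le hm ha _).trans (mul_le_mul_right ?_ 2)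
  exact le_iSup_of_le s₁ (le_iSup_of_le s₂ (le_iSup_of_le hs le_rfl))

end PMWidth

theorem mainTheorem4 {V : Type u} [Finite V] {W : Type w}
    (G : SimpleGraph V) (H : SimpleGraph W)
    (hG : PMWidth.MatchingCovered G) (hH : PMWidth.IsBrickOrBraceOf H G) :
    PMWidth.pmw H ≤ 2 * PMWidth.pmw G := by
  rcases isEmpty_or_nonempty (PMWidth.PMDecomposition G) with h | h
  · simp [PMWidth.pmw, iInf_of_empty]
  -- A nonempty infimum in `ℕ∞` is attained, so a single optimal decomposition suffices.
  · obtain ⟨D, hD⟩ := ENat.exists_eq_iInf (fun D : PMWidth.PMDecomposition G => D.width)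
    rw [show PMWidth.pmw G = D.width from hD.symm]
    exact D.pmw_le hG hH
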